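/- Let $c_0$ be the Banach space of real null sequences with the supremum norm. For a linear subspace $L\subseteq\mathbb R^{\mathbb N}$ let $\mathbb R^{\mathbb N}/L$ denote the equivalence relation $a\sim b\iff a-b\in L$ on the Polish space $\mathbb R^{\mathbb N}$ (product topology). For a sequence $(x_n)_{n\in\mathbb N}$ in a real Banach space $X$ put $$\mathrm{coef}(X,(x_n))=\Big\{a\in\mathbb R^{\mathbb N}:\sum_{n}a(n)x_n\text{ converges in }X\Big\},\qquad E(X,(x_n))=\mathbb R^{\mathbb N}/\mathrm{coef}(X,(x_n)).$$ For equivalence relations $E$, $F$ on Polish spaces $Y$, $Z$ write $E\le_B F$ if there is a Borel map $\theta:Y\to Z$ with $u\mathrel{E}v\iff\theta(u)\mathrel{F}\theta(v)$ for all $u,v\in Y$. Fix a bijection $\langle\cdot,\cdot\rangle:\mathbb N^2\to\mathbb N$ such that, for each $i$, $\langle i,j\rangle$ is strictly increasing in $j$. Let $(\bigoplus_{i\in\mathbb N}c_0)_0$ be the Banach space of sequences $(a_i)$ in $c_0$ with $\|a_i\|\to0$, with norm $\sup_i\|a_i\|$, identified with $c_0$ by the linear isometry that puts the $k$-th coordinate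 of $a_i$ in position $\langle i,k\rangle$. Let $(e^i_k)_k$ be the unit vector basis of the $i$-th summand, and for $n=\langle i,j\rangle$ let $x^\infty_n=\sum_{k\le j}e^i_k$. Put $\mathrm{cs}^{(\infty)}=\mathrm{coef}(c_0,(x^\infty_n))$. Theorem. For every sequence $(x_n)$ of nonzero elements of $c_0$, $$\mathbb R^{\mathbb N}/c_0\ \le_B\ E(c_0,(x_n))\ \le_B\ \mathbb R^{\mathbb N}/\mathrm{cs}^{(\infty)}.$$ Hence, among the equivalence relations $E(c_0,(x_n))$ with $(x_n)$ a sequence of nonzero elements of $c_0$, $\mathbb R^{\mathbb N}/c_0$ is the minimum and $\mathbb R^{\mathbb N}/\mathrm{cs}^{(\infty)}$ is the maximum with respect to $\le_B$; in particular, both relations belong to this class. -/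

import Mathlib

open Filter Topology Finset
open scoped ZeroAtInfty

/-! Borel reducibility -/

/-- `E ≤_B F`: there is a Borel map `θ : X → Y` between the underlying Polish spaces with
`x E y ↔ θ x F θ y` for all `x, y`. -/
def BorelReducible {X Y : Type*}
    [TopologicalSpace X] [PolishSpace X] [MeasurableSpace X] [BorelSpace X]
    [TopologicalSpace Y] [PolishSpace Y] [MeasurableSpace Y] [BorelSpace Y]
    (E : Setoid X) (F : Setoid Y) : Prop :=
  ∃ θ : X → Y, Measurable θ ∧ ∀ x y : X, E x y ↔ F (θ x) (θ y)

/-! Schauder equivalence relations -/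

/-- The equivalence relation `ℝ^ℕ / L` on `ℝ^ℕ` (product topology): `a ∼ b ↔ a - b ∈ L`. -/
def seqQuotient (L : Submodule ℝ (ℕ → ℝ)) : Setoid (ℕ → ℝ) where
  r a b := a - b ∈ L
  iseqv :=
    { refl := fun a => by simp
      symm := fun {a b} h => by simpa using L.neg_mem h
      trans := fun {a b c} h₁ h₂ => by simpa using L.add_mem h₁ h₂ }

/-- `coef(X, (x_n))`: all real sequences `a` for which the series `∑ a(n) x_n` converges
(its partial sums, in the given order, have a limit in `X`). -/
def coef (X : Type*) [NormedAddCommGroup X] [NormedSpace ℝ X] (x : ℕ → X) :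
    Submodule ℝ (ℕ → ℝ) where
  carrier := {a | ∃ s : X, Tendsto (fun N => ∑ n ∈ range N, a n • x n) atTop (𝓝 s)}
  zero_mem' := ⟨0, by simp⟩
  add_mem' := by
    rintro a b ⟨s, hs⟩ ⟨t, ht⟩
    refine ⟨s + t, ?_⟩
    simpa [add_smul, Finset.sum_add_distrib] using hs.add ht
  smul_mem' := by
    rintro c a ⟨s, hs⟩
    refine ⟨c • s, ?_⟩
    simpa [mul_smul, Finset.smul_sum] using hs.const_smul c

/-- `E(X, (x_n)) = ℝ^ℕ / coef(X, (x_n))`. -/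
def schauderRel (X : Type*) [NormedAddCommGroup X] [NormedSpace ℝ X] (x : ℕ → X) :
    Setoid (ℕ → ℝ) :=
  seqQuotient (coef X x)

/-! The space `c_0` and its `c_0`-sum -/

/-- The Banach space `c_0` of real null sequences, with the supremum norm. -/
abbrev C0 : Type := C₀(ℕ, ℝ)

/-- The Banach space `(⨁_{i ∈ ℕ} c_0)_0` of all sequences in `c_0` whose norms tend to `0`, with
the supremum of the norms as its norm. -/
abbrev C0Sum : Type := C₀(ℕ, C0)

/-- `c_0` as a linear subspace of `ℝ^ℕ`. -/
def c0Seq : Submodule ℝ (ℕ → ℝ) where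
  carrier := {a | Tendsto a atTop (𝓝 0)}
  zero_mem' := tendsto_const_nhds
  add_mem' := by
    intro a b ha hb
    have h : Tendsto (fun n => a n + b n) atTop (𝓝 (0 + 0)) := Tendsto.add ha hb
    rw [add_zero] at h
    exact h
  smul_mem' := by
    intro c a ha
    have h : Tendsto (fun n => c • a n) atTop (𝓝 (c • 0)) := Tendsto.const_smul ha c
    rw [smul_zero] at h
    exact h

/-- The class of Schauder equivalence relations generated by sequences of nonzero elements
of `c_0`. -/
def schauderRelsOfC0 : Set (Setoid (ℕ → ℝ)) :=
  {E | ∃ x : ℕ → C0, (∀ n, x n ≠ 0) ∧ E = schauderRel C0 x}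

/-- The finitely supported sequence with value `v` in position `i` and `0` elsewhere. -/
def c0Single {V : Type*} [NormedAddCommGroup V] (i : ℕ) (v : V) : C₀(ℕ, V) where
  toFun := Pi.single i v
  continuous_toFun := continuous_of_discreteTopology
  zero_at_infty' := by
    rw [cocompact_eq_cofinite]
    refine tendsto_const_nhds.congr' ?_
    filter_upwards [(Set.finite_singleton i).compl_mem_cofinite] with n hn
    have hni : n ≠ i := hn
    simp [hni]

/-- The isometric isomorphism `(⨁_i c_0)_0 ≅ c_0` that lists the coordinate with index `(i, k)`
in position `⟨i, k⟩ = p (i, k)`. -/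
noncomputable def c0SumEquiv (p : ℕ × ℕ ≃ ℕ) : C0Sum ≃ₗᵢ[ℝ] C0 where
  toFun f :=
    { toFun := fun n => f (p.symm n).1 (p.symm n).2
      continuous_toFun := continuous_of_discreteTopology
      zero_at_infty' := by
        rw [cocompact_eq_cofinite]
        rw [Metric.tendsto_nhds]
        intro ε hε
        have h1 := f.zero_at_infty'
        rw [cocompact_eq_cofinite, Metric.tendsto_nhds] at h1
        have hA : {i | ¬ dist (f i) 0 < ε}.Finite := h1 ε hε
        have hB : ∀ i, {k | ¬ dist (f i k) 0 < ε}.Finite := by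
          intro i
          have h2 := (f i).zero_at_infty'
          rw [cocompact_eq_cofinite, Metric.tendsto_nhds] at h2
          exact h2 ε hε
        have hC : (⋃ i ∈ {i | ¬ dist (f i) 0 < ε},
            (fun k => p (i, k)) '' {k | ¬ dist (f i k) 0 < ε}).Finite :=
          hA.biUnion fun i _ => (hB i).image _
        refine hC.subset ?_
        intro n hn
        have hn' : ¬ dist (f (p.symm n).1 (p.symm n).2) 0 < ε := hn
        simp only [Set.mem_iUnion]
        refine ⟨(p.symm n).1, ?_, (p.symm n).2, hn', by simp⟩
        intro hlt
        apply hn'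
        refine lt_of_le_of_lt ?_ hlt
        rw [dist_zero_right, dist_zero_right]
        exact (f (p.symm n).1).toBCF.norm_coe_le_norm _ }
  invFun g :=
    { toFun := fun i =>
        { toFun := fun k => g (p (i, k))
          continuous_toFun := continuous_of_discreteTopology
          zero_at_infty' := by
            have h := g.zero_at_infty'
            rw [cocompact_eq_cofinite] at h ⊢
            exact h.comp
              (p.injective.comp (Prod.mk_right_injective i)).tendsto_cofinite }
      continuous_toFun := continuous_of_discreteTopology
      zero_at_infty' := by
        rw [Metric.tendsto_nhds]
        intro ε hε
        refine Filter.Eventually.filter_mono (cocompact_eq_cofinite ℕ).le ?_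
        have h := g.zero_at_infty'
        rw [cocompact_eq_cofinite, Metric.tendsto_nhds] at h
        have hA : {n | ¬ dist (g n) 0 < ε / 2}.Finite := h (ε / 2) (half_pos hε)
        refine (hA.image fun n => (p.symm n).1).subset ?_
        intro i hi
        by_contra hcon
        apply hi
        refine lt_of_eq_of_lt (dist_zero_right _) ?_
        refine lt_of_le_of_lt ?_ (half_lt_self hε)
        refine (BoundedContinuousFunction.norm_le (half_pos hε).le).2 ?_
        intro k
        by_contra hk
        refine hcon ⟨p (i, k), ?_, by simp⟩
        intro hlt
        rw [dist_zero_right] at hlt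
        exact hk hlt.le }
  left_inv f := by
    ext i k
    simp
  right_inv g := by
    ext n
    simp
  map_add' f g := by
    ext n
    simp
  map_smul' c f := by
    ext n
    simp
  norm_map' f := by
    apply le_antisymm
    · refine (BoundedContinuousFunction.norm_le (norm_nonneg f)).2 ?_
      intro n
      exact ((f (p.symm n).1).toBCF.norm_coe_le_norm _).trans (f.toBCF.norm_coe_le_norm _)
    · refine (BoundedContinuousFunction.norm_le (norm_nonneg _)).2 ?_
      intro i
      refine (BoundedContinuousFunction.norm_le (norm_nonneg _)).2 ?_
      intro k
      refine le_trans (le_of_eq ?_)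
        (ZeroAtInftyContinuousMap.toBCF _ |>.norm_coe_le_norm (p (i, k)))
      change ‖f i k‖ = ‖f (p.symm (p (i, k))).1 (p.symm (p (i, k))).2‖
      rw [Equiv.symm_apply_apply]

/-! The space `cs^(∞)` -/

/-- The vector `∑_{k ≤ j} e^i_k` of `(⨁_i c_0)_0` for `n = ⟨i, j⟩ = p (i, j)`, where `(e^i_k)_k` is
the unit vector basis of the `i`-th summand `c_0`. -/
noncomputable def csInftyVec (p : ℕ × ℕ ≃ ℕ) (n : ℕ) : C0Sum :=
  ∑ k ∈ range ((p.symm n).2 + 1), c0Single (p.symm n).1 (c0Single k (1 : ℝ))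

/-- The sequence `(x^∞_n)` in `c_0`, through the identification `(⨁_i c_0)_0 ≅ c_0`. -/
noncomputable def csInftyGen (p : ℕ × ℕ ≃ ℕ) (n : ℕ) : C0 :=
  c0SumEquiv p (csInftyVec p n)

/-- `cs^(∞) = coef(c_0, (x^∞_n))`. -/
noncomputable def csInfty (p : ℕ × ℕ ≃ ℕ) : Submodule ℝ (ℕ → ℝ) :=
  coef C0 (csInftyGen p)

/-! Both reductions are linear maps that repeat and rescale coordinates, so only membership in the
two subspaces has to be compared. Upper bound: partial sums in `c_0` converge iff every coordinate
converges and the suprema of the coordinates over all partial sums tend to zero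
(`c0_exists_tendsto_iff`). Membership in `cs^(∞)` is the same condition on rows (`mem_csInfty_iff`),
so writing the scalar series at coordinate `i` into row `i` is a reduction. Lower bound: normalize,
pass to a pointwise convergent subsequence, and take differences of consecutive members. A gliding
hump makes these almost disjoint, so null coefficients give convergent sums
(`c0_exists_subseq_sum_abs_sub_le`). Conversely, the terms of a convergent series tend to zero, and
the individual terms, unlike the differences, have norm exactly `|a k|`. -/

/-! ### Linear reductions and sums along a subsequence. -/

theorem borelReducible_seqQuotient_of_weights {L M : Submodule ℝ (ℕ → ℝ)} (κ : ℕ → ℕ) (c : ℕ → ℝ)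
    (h : ∀ a, a ∈ L ↔ (fun n => c n * a (κ n)) ∈ M) :
    BorelReducible (seqQuotient L) (seqQuotient M) := by
  refine ⟨fun a n => c n * a (κ n), ?_, fun a b => ?_⟩
  · exact measurable_pi_iff.2 fun n =>
      (measurable_pi_apply (X := fun _ : ℕ => ℝ) (κ n)).const_mul (c n)
  · change a - b ∈ L ↔ (fun n => c n * a (κ n)) - (fun n => c n * b (κ n)) ∈ M
    rw [h (a - b)]
    have : (fun n => c n * (a - b) (κ n))
        = (fun n => c n * a (κ n)) - (fun n => c n * b (κ n)) := by
      ext n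
      simp [mul_sub]
    rw [this]

theorem exists_forall_lt_iff_lt_of_strictMono {h : ℕ → ℕ} (hh : StrictMono h) (N : ℕ) :
    ∃ J, ∀ j, h j < N ↔ j < J := by
  classical
  have hex : ∃ j, N ≤ h j := ⟨N, hh.le_apply⟩
  refine ⟨Nat.find hex, fun j => ⟨fun hj => ?_, fun hj => ?_⟩⟩
  · by_contra hcon
    exact absurd (hh.monotone (not_lt.1 hcon)) (by have := Nat.find_spec hex; omega)
  · exact not_le.1 (Nat.find_min hex hj)

theorem tendsto_atTop_of_forall_lt_iff_lt {h J : ℕ → ℕ} (hJ : ∀ N j, h j < N ↔ j < J N) :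
    Tendsto J atTop atTop := by
  refine tendsto_atTop.2 fun b => ?_
  filter_upwards [eventually_gt_atTop (h b)] with N hN
  exact ((hJ N b).1 hN).le

theorem sum_range_eq_sum_range_comp {E : Type*} [AddCommMonoid E] {h : ℕ → ℕ} (hh : StrictMono h)
    {f : ℕ → E} (hf : ∀ n, n ∉ Set.range h → f n = 0) {N J : ℕ} (hJ : ∀ j, h j < N ↔ j < J) :
    ∑ n ∈ range N, f n = ∑ j ∈ range J, f (h j) := by
  rw [← Finset.sum_image (f := f) (g := h) (s := range J) (fun a _ b _ hab => hh.injective hab)]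
  symm
  refine Finset.sum_subset ?_ ?_
  · intro n hn
    obtain ⟨j, hj, rfl⟩ := Finset.mem_image.1 hn
    exact Finset.mem_range.2 ((hJ j).2 (Finset.mem_range.1 hj))
  · intro n hn hn'
    refine hf n ?_
    rintro ⟨j, rfl⟩
    exact hn' (Finset.mem_image_of_mem _ (Finset.mem_range.2 ((hJ j).1 (Finset.mem_range.1 hn))))

/-! Convergence in `c_0` -/

theorem c0_abs_apply_le (f : C0) (i : ℕ) : |f i| ≤ ‖f‖ :=
  f.toBCF.norm_coe_le_norm i

theorem c0_norm_le {f : C0} {C : ℝ} (hC : 0 ≤ C) (h : ∀ i, |f i| ≤ C) : ‖f‖ ≤ C :=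
  (BoundedContinuousFunction.norm_le hC).2 h

theorem c0_sum_apply {V ι : Type*} [NormedAddCommGroup V] (s : Finset ι) (f : ι → C₀(ℕ, V))
    (i : ℕ) : (∑ k ∈ s, f k) i = ∑ k ∈ s, f k i := by
  classical
  induction s using Finset.induction_on with
  | empty => simp
  | insert k s hk ih => simp [Finset.sum_insert hk, ih]

theorem c0_finite_lt_abs (f : C0) {ε : ℝ} (hε : 0 < ε) : {i | ε < |f i|}.Finite := by
  have h := f.zero_at_infty'
  rw [cocompact_eq_cofinite, Metric.tendsto_nhds] at h
  have h1 : {i | ¬ dist (f i) 0 < ε}.Finite := h ε hε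
  refine h1.subset fun i hi => ?_
  have hi' : ε < |f i| := hi
  simpa [Real.dist_eq] using hi'.le

/-- A sequence in `c_0` converges iff it converges in every coordinate and its members tend to
zero along the coordinates uniformly. -/
theorem c0_exists_tendsto_iff (S : ℕ → C0) :
    (∃ s, Tendsto S atTop (𝓝 s)) ↔
      (∀ k, ∃ l, Tendsto (fun N => S N k) atTop (𝓝 l)) ∧
        ∀ ε > 0, {k | ∃ N, ε < |S N k|}.Finite := by
  constructor
  · rintro ⟨s, hs⟩
    have hdist := Metric.tendsto_atTop.1 hs
    constructor
    · intro k
      refine ⟨s k, Metric.tendsto_atTop.2 fun ε hε => ?_⟩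
      obtain ⟨N, hN⟩ := hdist ε hε
      refine ⟨N, fun n hn => lt_of_le_of_lt ?_ (hN n hn)⟩
      rw [Real.dist_eq, dist_eq_norm]
      exact c0_abs_apply_le (S n - s) k
    · intro ε hε
      obtain ⟨N, hN⟩ := hdist (ε / 2) (half_pos hε)
      -- Late members are within `ε / 2` of `s`; the finitely many early ones are null sequences
      -- themselves.
      refine ((c0_finite_lt_abs s (half_pos hε)).union
        ((Set.finite_lt_nat N).biUnion fun n _ => c0_finite_lt_abs (S n) hε)).subset ?_
      rintro k ⟨n, hn⟩
      rcases lt_or_ge n N with h | h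
      · exact Or.inr (Set.mem_biUnion h hn)
      · refine Or.inl ?_
        have h1 : |S n k - s k| < ε / 2 := by
          refine lt_of_le_of_lt (c0_abs_apply_le (S n - s) k) ?_
          rw [← dist_eq_norm]
          exact hN n h
        have h2 := abs_sub_abs_le_abs_sub (S n k) (s k)
        change ε / 2 < |s k|
        linarith
  · rintro ⟨hl, hfin⟩
    choose l hl using hl
    have hlfin : ∀ ε > 0, ∀ k, (∀ N, |S N k| ≤ ε) → |l k| ≤ ε := fun ε _ k hk =>
      le_of_tendsto (hl k).abs (Eventually.of_forall hk)
    let s : C0 :=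
      { toFun := l
        continuous_toFun := continuous_of_discreteTopology
        zero_at_infty' := by
          rw [cocompact_eq_cofinite, Metric.tendsto_nhds]
          intro ε hε
          refine (hfin (ε / 2) (half_pos hε)).subset fun k hk => ?_
          by_contra hcon
          refine hk ?_
          have : ∀ N, |S N k| ≤ ε / 2 := fun N => not_lt.1 fun h => hcon ⟨N, h⟩
          have := hlfin _ (half_pos hε) k this
          rw [Set.mem_ofPred_eq, Real.dist_eq, sub_zero]
          linarith }
    refine ⟨s, Metric.tendsto_nhds.2 fun ε hε => ?_⟩
    have h4 : 0 < ε / 4 := by positivity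
    -- Outside this finite set of coordinates both `S N k` and `l k` are at most `ε / 4`.
    have hev : ∀ᶠ N in atTop, ∀ k ∈ {k | ∃ N, ε / 4 < |S N k|}, |S N k - l k| < ε / 2 := by
      refine (Filter.eventually_all_finite (hfin _ h4)).2 fun k _ => ?_
      exact (Metric.tendsto_nhds.1 (hl k)) _ (half_pos hε)
    filter_upwards [hev] with N hN
    rw [dist_eq_norm]
    refine lt_of_le_of_lt (c0_norm_le (half_pos hε).le fun k => ?_) (half_lt_self hε)
    change |S N k - l k| ≤ ε / 2
    by_cases hk : ∃ N, ε / 4 < |S N k|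
    · exact (hN k hk).le
    · have hk' : ∀ N, |S N k| ≤ ε / 4 := fun N => not_lt.1 fun h => hk ⟨N, h⟩
      have h1 := hlfin _ h4 k hk'
      have h2 := abs_sub (S N k) (l k)
      have h3 := hk' N
      linarith

/-- If `∑ |u_k(i)|` is bounded uniformly in `i`, then `∑ a_k u_k` is summable in `c_0` for every
null sequence `a`. -/
theorem c0_summable_smul_of_sum_abs_le {u : ℕ → C0} {C : ℝ}
    (hu : ∀ (i : ℕ) (t : Finset ℕ), ∑ k ∈ t, |u k i| ≤ C) {a : ℕ → ℝ}
    (ha : Tendsto a atTop (𝓝 0)) : Summable fun k => a k • u k := by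
  have hC : 0 ≤ C := by simpa using hu 0 ∅
  refine summable_iff_vanishing_norm.2 fun ε hε => ?_
  have hδ : 0 < ε / (2 * (C + 1)) := by positivity
  obtain ⟨K, hK⟩ := Metric.tendsto_atTop.1 ha _ hδ
  refine ⟨range K, fun t ht => ?_⟩
  refine lt_of_le_of_lt (c0_norm_le (half_pos hε).le fun i => ?_) (half_lt_self hε)
  rw [c0_sum_apply]
  calc |∑ k ∈ t, (a k • u k) i| ≤ ∑ k ∈ t, |(a k • u k) i| := Finset.abs_sum_le_sum_abs _ _
    _ ≤ ∑ k ∈ t, ε / (2 * (C + 1)) * |u k i| := by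
        refine Finset.sum_le_sum fun k hk => ?_
        have hkK : K ≤ k := by
          by_contra hcon
          exact (Finset.disjoint_left.1 ht hk) (Finset.mem_range.2 (not_le.1 hcon))
        have h1 := hK k hkK
        rw [Real.dist_eq, sub_zero] at h1
        rw [ZeroAtInftyContinuousMap.smul_apply, smul_eq_mul, abs_mul]
        exact mul_le_mul_of_nonneg_right h1.le (abs_nonneg _)
    _ = ε / (2 * (C + 1)) * ∑ k ∈ t, |u k i| := by rw [Finset.mul_sum]
    _ ≤ ε / (2 * (C + 1)) * (C + 1) :=
        mul_le_mul_of_nonneg_left ((hu i t).trans (by linarith)) hδ.le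
    _ = ε / 2 := by field_simp

theorem tendsto_smul_zero_of_mem_coef {X : Type*} [NormedAddCommGroup X] [NormedSpace ℝ X]
    {x : ℕ → X} {a : ℕ → ℝ} (ha : a ∈ coef X x) : Tendsto (fun n => a n • x n) atTop (𝓝 0) := by
  obtain ⟨s, hs⟩ := ha
  have h := ((tendsto_add_atTop_iff_nat 1).2 hs).sub hs
  simpa [Finset.sum_range_succ] using h

theorem c0Single_apply {V : Type*} [NormedAddCommGroup V] (i : ℕ) (v : V) (k : ℕ) :
    c0Single i v k = if k = i then v else 0 := by
  change (Pi.single i v : ℕ → V) k = _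
  rw [Pi.single_apply]

theorem c0Seq_eq_coef_c0Single : c0Seq = coef C0 fun n => c0Single n (1 : ℝ) := by
  ext a
  constructor
  · intro ha
    have hu : ∀ (i : ℕ) (t : Finset ℕ), ∑ k ∈ t, |(c0Single k (1 : ℝ) : C0) i| ≤ 1 := by
      intro i t
      simp only [c0Single_apply, apply_ite abs, abs_one, abs_zero, Finset.sum_ite_eq]
      split_ifs <;> norm_num
    exact ⟨_, (c0_summable_smul_of_sum_abs_le hu ha).hasSum.tendsto_sum_nat⟩
  · intro ha
    refine squeeze_zero_norm (fun n => ?_) (tendsto_zero_iff_norm_tendsto_zero.1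
      (tendsto_smul_zero_of_mem_coef ha))
    have h := c0_abs_apply_le (a n • (c0Single n (1 : ℝ) : C0)) n
    simpa [c0Single_apply] using h

/-! The upper bound -/

theorem csInftyGen_apply (p : ℕ × ℕ ≃ ℕ) (n i k : ℕ) :
    csInftyGen p n (p (i, k)) = if i = (p.symm n).1 ∧ k ≤ (p.symm n).2 then 1 else 0 := by
  change csInftyVec p n (p.symm (p (i, k))).1 (p.symm (p (i, k))).2 = _
  simp only [Equiv.symm_apply_apply, csInftyVec, c0_sum_apply, c0Single_apply]
  by_cases hi : i = (p.symm n).1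
  · simp only [hi, if_true, c0Single_apply, true_and]
    simp
  · simp [hi]

theorem csInftyGen_ne_zero (p : ℕ × ℕ ≃ ℕ) (n : ℕ) : csInftyGen p n ≠ 0 := by
  intro h
  have h1 := csInftyGen_apply p n (p.symm n).1 (p.symm n).2
  rw [h] at h1
  simp at h1

/-- Only row `i` contributes, and there only the vectors with `j ≥ k` reach coordinate `k`. -/
theorem csInfty_partialSum_apply {p : ℕ × ℕ ≃ ℕ} (hp : ∀ i, StrictMono fun j => p (i, j))
    (b : ℕ → ℝ) (i k : ℕ) {N J : ℕ} (hJ : ∀ j, p (i, j) < N ↔ j < J) :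
    (∑ n ∈ range N, b n • csInftyGen p n) (p (i, k)) = ∑ j ∈ Ico k J, b (p (i, j)) := by
  rw [c0_sum_apply]
  have hsum := sum_range_eq_sum_range_comp (hp i)
    (f := fun n => (b n • csInftyGen p n) (p (i, k))) (N := N) (J := J) ?_ hJ
  · rw [hsum]
    simp only [ZeroAtInftyContinuousMap.smul_apply, csInftyGen_apply, Equiv.symm_apply_apply,
      true_and, smul_eq_mul, mul_ite, mul_one, mul_zero]
    rw [← Finset.sum_filter]
    refine Finset.sum_congr ?_ fun _ _ => rfl
    ext j
    simp [and_comm]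
  · intro n hn
    have : i ≠ (p.symm n).1 := by
      rintro rfl
      exact hn ⟨(p.symm n).2, by simp⟩
    simp [csInftyGen_apply, this]

/-- A sequence lies in `cs^(∞)` iff all its rows are convergent series and the suprema of the
partial sums of the rows tend to zero. -/
theorem mem_csInfty_iff {p : ℕ × ℕ ≃ ℕ} (hp : ∀ i, StrictMono fun j => p (i, j)) (b : ℕ → ℝ) :
    b ∈ csInfty p ↔
      (∀ i, ∃ l, Tendsto (fun N => ∑ j ∈ range N, b (p (i, j))) atTop (𝓝 l)) ∧
        ∀ ε > 0, {i | ∃ N, ε < |∑ j ∈ range N, b (p (i, j))|}.Finite := by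
  choose J hJ using fun i => exists_forall_lt_iff_lt_of_strictMono (hp i)
  have hJp : ∀ i M, J i (p (i, M)) = M := by
    intro i M
    refine le_antisymm ?_ ?_
    · by_contra hcon
      exact lt_irrefl _ ((hJ i (p (i, M)) M).2 (not_le.1 hcon))
    · by_contra hcon
      have h1 := mt (hJ i (p (i, M)) (J i (p (i, M)))).1 (lt_irrefl _)
      exact h1 (hp i (not_le.1 hcon))
  have hS : ∀ N i k, (∑ n ∈ range N, b n • csInftyGen p n) (p (i, k))
      = ∑ j ∈ Ico k (J i N), b (p (i, j)) := fun N i k =>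
    csInfty_partialSum_apply hp b i k (hJ i N)
  refine (c0_exists_tendsto_iff _).trans ⟨?_, ?_⟩
  · rintro ⟨hconv, hfin⟩
    constructor
    · intro i
      obtain ⟨l, hl⟩ := hconv (p (i, 0))
      refine ⟨l, ?_⟩
      -- Stopping at `N = p (i, M)` leaves exactly the first `M` entries of row `i`.
      have h := hl.comp (hp i).tendsto_atTop
      refine h.congr fun M => ?_
      simp only [Function.comp_apply]
      rw [hS, hJp, Nat.Ico_zero_eq_range]
    · intro ε hε
      refine Set.Finite.of_injOn (f := fun i => p (i, 0)) ?_ ?_ (hfin ε hε)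
      · rintro i ⟨M, hM⟩
        refine ⟨p (i, M), ?_⟩
        rwa [hS, hJp, Nat.Ico_zero_eq_range]
      · intro i _ i' _ h
        exact congrArg Prod.fst (p.injective h)
  · rintro ⟨hconv, hfin⟩
    constructor
    · intro n
      obtain ⟨⟨i, k⟩, rfl⟩ := p.surjective n
      obtain ⟨l, hl⟩ := hconv i
      have hJt := tendsto_atTop_of_forall_lt_iff_lt (hJ i)
      refine ⟨l - ∑ j ∈ range k, b (p (i, j)), ?_⟩
      refine ((hl.comp hJt).sub_const _).congr' ?_
      filter_upwards [hJt.eventually_ge_atTop k] with N hN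
      rw [hS, Finset.sum_Ico_eq_sub _ hN]
      rfl
    · intro ε hε
      have hrow : ∀ i, {k | ∃ M, ε < |∑ j ∈ Ico k M, b (p (i, j))|}.Finite := by
        intro i
        obtain ⟨l, hl⟩ := hconv i
        obtain ⟨K, hK⟩ := Metric.cauchySeq_iff.1 hl.cauchySeq ε hε
        refine (Set.finite_lt_nat K).subset ?_
        rintro k ⟨M, hM⟩
        by_contra hcon
        have hk : K ≤ k := not_lt.1 hcon
        rcases le_total k M with h | h
        · rw [Finset.sum_Ico_eq_sub _ h, ← Real.dist_eq] at hM
          exact lt_asymm hM (hK M (hk.trans h) k hk)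
        · rw [Finset.Ico_eq_empty_of_le h, Finset.sum_empty, abs_zero] at hM
          exact lt_asymm hM hε
      -- A block sum is a difference of two partial sums, so only rows exceeding `ε / 2` matter; in
      -- each of them the Cauchy property leaves finitely many `k`.
      refine ((hfin (ε / 2) (half_pos hε)).biUnion fun i _ =>
        (hrow i).image fun k => p (i, k)).subset ?_
      rintro n ⟨N, hN⟩
      obtain ⟨⟨i, k⟩, rfl⟩ := p.surjective n
      rw [hS] at hN
      refine Set.mem_biUnion (x := i) ?_ ⟨k, ⟨J i N, hN⟩, rfl⟩
      by_contra hcon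
      have hsmall : ∀ M, |∑ j ∈ range M, b (p (i, j))| ≤ ε / 2 := fun M =>
        not_lt.1 fun h => hcon ⟨M, h⟩
      rcases le_total k (J i N) with h | h
      · rw [Finset.sum_Ico_eq_sub _ h] at hN
        have h1 := abs_sub (∑ j ∈ range (J i N), b (p (i, j))) (∑ j ∈ range k, b (p (i, j)))
        linarith [hsmall (J i N), hsmall k]
      · rw [Finset.Ico_eq_empty_of_le h, Finset.sum_empty, abs_zero] at hN
        exact lt_asymm hN hε

theorem schauderRel_borelReducible_csInfty {p : ℕ × ℕ ≃ ℕ}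
    (hp : ∀ i, StrictMono fun j => p (i, j)) (x : ℕ → C0) :
    BorelReducible (schauderRel C0 x) (seqQuotient (csInfty p)) := by
  refine borelReducible_seqQuotient_of_weights (fun n => (p.symm n).2)
    (fun n => x (p.symm n).2 (p.symm n).1) fun a => ?_
  rw [mem_csInfty_iff hp]
  refine (c0_exists_tendsto_iff _).trans ?_
  simp only [c0_sum_apply, ZeroAtInftyContinuousMap.smul_apply, Equiv.symm_apply_apply, smul_eq_mul,
    mul_comm]

/-! The lower bound -/

theorem c0_exists_subseq_tendsto_apply {z : ℕ → C0} (hz : ∀ n, ‖z n‖ ≤ 1) :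
    ∃ (y : ℕ → ℝ) (φ : ℕ → ℕ), StrictMono φ ∧
      ∀ i, Tendsto (fun n => z (φ n) i) atTop (𝓝 (y i)) := by
  have hK : IsCompact (Set.univ.pi fun _ : ℕ => Set.Icc (-1 : ℝ) 1) :=
    isCompact_univ_pi fun _ => isCompact_Icc
  obtain ⟨y, -, φ, hφ, hy⟩ := hK.tendsto_subseq (x := fun n i => z n i) fun n i _ =>
    abs_le.1 ((c0_abs_apply_le (z n) i).trans (hz n))
  exact ⟨y, φ, hφ, tendsto_pi_nhds.1 hy⟩

/-- Beyond any index, a pointwise convergent sequence in `c_0` has two consecutive members whose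
difference is small outside some interval `[M, M')`, for any prescribed `M`. -/
theorem c0_exists_consecutive_sub_small {z : ℕ → C0} {y : ℕ → ℝ}
    (hy : ∀ i, Tendsto (fun n => z n i) atTop (𝓝 (y i))) {ε : ℝ} (hε : 0 < ε) (n M : ℕ) :
    ∃ q M', n ≤ q ∧ M ≤ M' ∧ ∀ i, i < M ∨ M' ≤ i → |z q i - z (q + 1) i| ≤ ε := by
  have hev : ∀ᶠ q in atTop, ∀ i ∈ Set.Iio M, |z q i - z (q + 1) i| < ε := by
    refine (Filter.eventually_all_finite (Set.finite_Iio M)).2 fun i _ => ?_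
    have h := (hy i).sub ((tendsto_add_atTop_iff_nat 1).2 (hy i))
    rw [sub_self] at h
    simpa [Real.dist_eq] using Metric.tendsto_nhds.1 h ε hε
  obtain ⟨q, hq, hnq⟩ := (hev.and (eventually_ge_atTop n)).exists
  obtain ⟨B, hB⟩ := (c0_finite_lt_abs (z q - z (q + 1)) hε).bddAbove
  -- `B` bounds the finitely many coordinates where the difference exceeds `ε`.
  refine ⟨q, max M (B + 1), hnq, le_max_left _ _, ?_⟩
  rintro i (hi | hi)
  · exact (hq i hi).le
  · by_contra hcon
    have := hB (a := i) (not_le.1 hcon)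
    have := (le_max_right _ _).trans hi
    omega

/-- Gliding hump: the `k`-th difference is at most `2⁻ᵏ` off its block and at most `2 + 2⁻ᵏ` on it.
The blocks are disjoint, so the total at any coordinate is at most `2 + 2 = 4`. -/
theorem c0_exists_subseq_sum_abs_sub_le {z : ℕ → C0} (hz : ∀ n, ‖z n‖ ≤ 1) :
    ∃ g : ℕ → ℕ, StrictMono g ∧ ∃ C : ℝ, ∀ (i : ℕ) (t : Finset ℕ),
      ∑ k ∈ t, |(z (g (2 * k)) - z (g (2 * k + 1))) i| ≤ C := by
  obtain ⟨y, φ, hφ, hy⟩ := c0_exists_subseq_tendsto_apply hz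
  choose Q R hnQ hMR hQR using fun k : ℕ =>
    c0_exists_consecutive_sub_small (z := fun n => z (φ n)) hy (ε := (1 / 2 : ℝ) ^ k)
      (by positivity)
  -- The state holds a lower bound for the next index and the left end of the next block; `+ 2`
  -- skips the pair `q k`, `q k + 1` already used.
  let st : ℕ → ℕ × ℕ := fun k =>
    Nat.rec (0, 0) (fun k s => (Q k s.1 s.2 + 2, R k s.1 s.2)) k
  let q : ℕ → ℕ := fun k => Q k (st k).1 (st k).2
  have hq : ∀ k, q k + 2 ≤ q (k + 1) := fun k => hnQ (k + 1) (st (k + 1)).1 (st (k + 1)).2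
  have hM : Monotone fun k => (st k).2 := monotone_nat_of_le_succ fun k => hMR k _ _
  have hsmall : ∀ k i, i < (st k).2 ∨ (st (k + 1)).2 ≤ i →
      |z (φ (q k)) i - z (φ (q k + 1)) i| ≤ (1 / 2 : ℝ) ^ k := fun k i => hQR k _ _ i
  have hmono : StrictMono fun j => q (j / 2) + j % 2 := by
    refine strictMono_nat_of_lt_succ fun j => ?_
    rcases Nat.even_or_odd' j with ⟨k, rfl | rfl⟩
    · have h1 : (2 * k + 1) / 2 = k := by omega
      have h2 : 2 * k / 2 = k := by omega
      simp only [h1, h2]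
      omega
    · have h1 : (2 * k + 1) / 2 = k := by omega
      have h2 : (2 * k + 1 + 1) / 2 = k + 1 := by omega
      have := hq k
      simp only [h1, h2]
      omega
  refine ⟨fun j => φ (q (j / 2) + j % 2), hφ.comp hmono, 4, fun i t => ?_⟩
  have hterm : ∀ k, |(z (φ (q (2 * k / 2) + 2 * k % 2))
      - z (φ (q ((2 * k + 1) / 2) + (2 * k + 1) % 2))) i|
      ≤ (1 / 2 : ℝ) ^ k + if (st k).2 ≤ i ∧ i < (st (k + 1)).2 then 2 else 0 := by
    intro k
    have h1 : (2 * k + 1) / 2 = k := by omega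
    have h2 : 2 * k / 2 = k := by omega
    have h3 : (2 * k + 1) % 2 = 1 := by omega
    have h4 : 2 * k % 2 = 0 := by omega
    rw [h1, h2, h3, h4, add_zero, ZeroAtInftyContinuousMap.sub_apply]
    split_ifs with h
    · have e1 := (c0_abs_apply_le (z (φ (q k))) i).trans (hz _)
      have e2 := (c0_abs_apply_le (z (φ (q k + 1))) i).trans (hz _)
      have e3 := abs_sub (z (φ (q k)) i) (z (φ (q k + 1)) i)
      have e4 : (0 : ℝ) ≤ (1 / 2 : ℝ) ^ k := by positivity
      linarith
    · rw [add_zero]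
      refine hsmall k i ?_
      by_contra hcon
      push Not at hcon
      exact h hcon
  refine (Finset.sum_le_sum fun k _ => hterm k).trans ?_
  rw [Finset.sum_add_distrib]
  have hgeom : ∑ k ∈ t, (1 / 2 : ℝ) ^ k ≤ 2 := by
    refine le_of_le_of_eq ?_ tsum_geometric_two
    exact summable_geometric_two.sum_le_tsum t fun k _ => by positivity
  have hcard : (t.filter fun k => (st k).2 ≤ i ∧ i < (st (k + 1)).2).card ≤ 1 := by
    have key : ∀ k k', (st k').2 ≤ i → i < (st (k + 1)).2 → k' ≤ k := by
      intro k k' h1 h2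
      by_contra hcon
      have h3 : (st (k + 1)).2 ≤ (st k').2 := hM (not_le.1 hcon)
      omega
    refine Finset.card_le_one.2 fun k hk k' hk' => ?_
    obtain ⟨-, hk1, hk2⟩ := Finset.mem_filter.1 hk
    obtain ⟨-, hk1', hk2'⟩ := Finset.mem_filter.1 hk'
    exact le_antisymm (key k' k hk1 hk2') (key k k' hk1' hk2)
  have hind : ∑ k ∈ t, (if (st k).2 ≤ i ∧ i < (st (k + 1)).2 then (2 : ℝ) else 0) ≤ 2 := by
    rw [← Finset.sum_filter, Finset.sum_const, nsmul_eq_mul]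
    have : ((t.filter fun k => (st k).2 ≤ i ∧ i < (st (k + 1)).2).card : ℝ) ≤ 1 := by
      exact_mod_cast hcard
    linarith
  linarith

/-- Undoing the pairing costs at most one unpaired last term, which tends to zero. -/
theorem tendsto_sum_range_of_tendsto_sum_pairs {E : Type*} [NormedAddCommGroup E] {g : ℕ → E}
    {s : E} (hg : Tendsto g atTop (𝓝 0))
    (hs : Tendsto (fun K => ∑ k ∈ range K, (g (2 * k) + g (2 * k + 1))) atTop (𝓝 s)) :
    Tendsto (fun J => ∑ j ∈ range J, g j) atTop (𝓝 s) := by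
  have heven : ∀ K, ∑ j ∈ range (2 * K), g j = ∑ k ∈ range K, (g (2 * k) + g (2 * k + 1)) := by
    intro K
    induction K with
    | zero => simp
    | succ K ih => rw [mul_add, mul_one, Finset.sum_range_succ, Finset.sum_range_succ, ih,
        Finset.sum_range_succ, add_assoc]
  have hdiv : Tendsto (fun J : ℕ => J / 2) atTop atTop := Nat.tendsto_div_const_atTop two_ne_zero
  have hrem : Tendsto (fun J => ∑ j ∈ range J, g j
      - ∑ k ∈ range (J / 2), (g (2 * k) + g (2 * k + 1))) atTop (𝓝 0) := by
    refine squeeze_zero_norm (fun J => ?_)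
      (tendsto_zero_iff_norm_tendsto_zero.1 (hg.comp (hdiv.const_mul_atTop' two_pos)))
    rcases Nat.even_or_odd' J with ⟨k, rfl | rfl⟩
    · have h2 : 2 * k / 2 = k := by omega
      simp [h2, heven]
    · have h1 : (2 * k + 1) / 2 = k := by omega
      simp [h1, Finset.sum_range_succ _ (2 * k), heven]
  simpa using hrem.add (hs.comp hdiv)

theorem c0_borelReducible_schauderRel {x : ℕ → C0} (hx : ∀ n, x n ≠ 0) :
    BorelReducible (seqQuotient c0Seq) (schauderRel C0 x) := by
  have hnorm : ∀ n, ‖‖x n‖⁻¹ • x n‖ = 1 := fun n => norm_smul_inv_norm (𝕜 := ℝ) (hx n)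
  obtain ⟨g, hg, C, hC⟩ :=
    c0_exists_subseq_sum_abs_sub_le (z := fun n => ‖x n‖⁻¹ • x n) fun n => (hnorm n).le
  -- The coefficient `a k` is placed at `g (2 * k)` and `g (2 * k + 1)` with opposite signs. Off the
  -- range of `g` the weight vanishes, so the default of `κ` is immaterial.
  let κ : ℕ → ℕ := Function.extend g (fun j => j / 2) 0
  let c : ℕ → ℝ := Function.extend g (fun j => (-1) ^ j * ‖x (g j)‖⁻¹) 0
  have hκ : ∀ j, κ (g j) = j / 2 := fun j => hg.injective.extend_apply _ _ j
  have hc : ∀ j, c (g j) = (-1) ^ j * ‖x (g j)‖⁻¹ := fun j => hg.injective.extend_apply _ _ j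
  have hc0 : ∀ n, n ∉ Set.range g → c n = 0 := fun n hn => Function.extend_apply' _ _ _ hn
  have hterm : ∀ (a : ℕ → ℝ) j, (c (g j) * a (κ (g j))) • x (g j)
      = ((-1) ^ j * a (j / 2)) • (‖x (g j)‖⁻¹ • x (g j)) := by
    intro a j
    rw [hκ, hc, smul_smul]
    congr 1
    ring
  have hnt : ∀ (a : ℕ → ℝ) j, ‖(c (g j) * a (κ (g j))) • x (g j)‖ = |a (j / 2)| := by
    intro a j
    rw [hterm, norm_smul, hnorm, mul_one, norm_mul, norm_pow, norm_neg, norm_one, one_pow, one_mul,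
      Real.norm_eq_abs]
  refine borelReducible_seqQuotient_of_weights κ c fun a => ⟨fun ha => ?_, fun ha => ?_⟩
  · choose J hJ using exists_forall_lt_iff_lt_of_strictMono hg
    have hgt : Tendsto (fun j => (c (g j) * a (κ (g j))) • x (g j)) atTop (𝓝 0) := by
      refine tendsto_zero_iff_norm_tendsto_zero.2 ?_
      simp only [hnt]
      have h : Tendsto (fun j => a (j / 2)) atTop (𝓝 0) :=
        Tendsto.comp ha (Nat.tendsto_div_const_atTop two_ne_zero)
      simpa using h.abs
    have hsum := (c0_summable_smul_of_sum_abs_le hC ha).hasSum.tendsto_sum_nat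
    refine ⟨_, ((tendsto_sum_range_of_tendsto_sum_pairs hgt (hsum.congr fun K => ?_)).comp
      (tendsto_atTop_of_forall_lt_iff_lt hJ)).congr fun N => ?_⟩
    · refine Finset.sum_congr rfl fun k _ => ?_
      have h1 : (2 * k + 1) / 2 = k := by omega
      have h2 : 2 * k / 2 = k := by omega
      rw [hterm, hterm, h1, h2, pow_succ, pow_mul]
      ext i
      simp
      ring
    · refine (sum_range_eq_sum_range_comp hg (f := fun n => (c n * a (κ n)) • x n)
        (fun n hn => ?_) (hJ N)).symm
      simp [hc0 n hn]
  -- The terms at the positions `g (2 * k)` already recover `|a k|`.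
  · have h := (tendsto_smul_zero_of_mem_coef ha).comp
      (hg.tendsto_atTop.comp (tendsto_id.const_mul_atTop' two_pos))
    refine squeeze_zero_norm (fun k => ?_) (tendsto_zero_iff_norm_tendsto_zero.1 h)
    have h2 : 2 * k / 2 = k := by omega
    have := hnt a (2 * k)
    rw [h2] at this
    exact this.ge

/-! ### The minimum and the maximum of the class. -/

theorem theorem5p5 (p : ℕ × ℕ ≃ ℕ) (hp : ∀ i, StrictMono fun j => p (i, j)) :
    -- every nonzero sequence in `c_0`
    (∀ x : ℕ → C0, (∀ n, x n ≠ 0) →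
      BorelReducible (seqQuotient c0Seq) (schauderRel C0 x) ∧
      BorelReducible (schauderRel C0 x) (seqQuotient (csInfty p))) ∧
    -- `ℝ^ℕ / c_0` is the minimum of the class
    (seqQuotient c0Seq ∈ schauderRelsOfC0 ∧
      ∀ E ∈ schauderRelsOfC0, BorelReducible (seqQuotient c0Seq) E) ∧
    -- `ℝ^ℕ / cs^(∞)` is the maximum of the class
    (seqQuotient (csInfty p) ∈ schauderRelsOfC0 ∧
      ∀ E ∈ schauderRelsOfC0, BorelReducible E (seqQuotient (csInfty p))) := by
  have hupper := fun x : ℕ → C0 => schauderRel_borelReducible_csInfty hp x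
  refine ⟨fun x hx => ⟨c0_borelReducible_schauderRel hx, hupper x⟩, ⟨?_, ?_⟩, ⟨?_, ?_⟩⟩
  · refine ⟨fun n => c0Single n 1, fun n hn => ?_, ?_⟩
    · have h := DFunLike.congr_fun hn n
      simp [c0Single_apply] at h
    · rw [schauderRel, ← c0Seq_eq_coef_c0Single]
  · rintro E ⟨x, hx, rfl⟩
    exact c0_borelReducible_schauderRel hx
  · exact ⟨csInftyGen p, csInftyGen_ne_zero p, rfl⟩
  · rintro E ⟨x, -, rfl⟩
    exact hupper x
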